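/- Let $(X,d)$ be a metric space and let $\phi:X\to(-\infty,+\infty]$ be a proper, lower semicontinuous functional with domain $\mathrm{Dom}(\phi)=\{\phi<+\infty\}$. Its metric slope is $|\partial\phi|(x)=\limsup_{y\to x}\frac{(\phi(x)-\phi(y))^+}{d(x,y)}$ for $x\in\mathrm{Dom}(\phi)$ (equal to $0$ if $x$ is isolated) and $|\partial\phi|(x)=+\infty$ for $x\notin\mathrm{Dom}(\phi)$; put $\mathrm{Dom}(|\partial\phi|)=\{|\partial\phi|<+\infty\}$. For $a\in\mathbb R$ and $t\ge 0$ let $\mathsf E_a(t)=\int_0^t e^{ar}\,dr$. Let $\lambda\le 0$, let $D\subset\overline{\mathrm{Dom}(\phi)}$, and let $(\mathsf S_t)_{t\ge0}$ be an $\mathrm{EVI}_\lambda$-gradient flow of $\phi$ in $D$, i.e. a family of continuous maps $\mathsf S_t:D\to D$ such that for every $x\in D$: $\mathsf S_{t+h}(x)=\mathsf S_h(\mathsf S_t(x))$ for all $t,h\ge0$; $\lim_{t\downarrow0}\mathsf S_t(x)=\mathsf S_0(x)=x$; and $u_t:=\mathsf S_t(x)$ is a continuous curve from $(0,+\infty)$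 to $\mathrm{Dom}(\phi)$ with $$\frac12\,\frac{d}{dt}^{\!+} d^2(u_t,v)+\frac\lambda2\,d^2(u_t,v)\le\phi(v)-\phi(u_t)\qquad\text{for all }t>0,\ v\in\mathrm{Dom}(\phi),$$ where $\frac{d}{dt}^{+}\zeta(t)=\limsup_{h\downarrow0}\frac{\zeta(t+h)-\zeta(t)}h$. Let $\tau>0$, $\eta\ge0$, $\varepsilon\ge0$, and put $\gamma:=2\eta-3\lambda$; assume $4\gamma\tau\le1$. Let $(U^n)_{n\ge0}$ be a sequence in $D\cap\mathrm{Dom}(|\partial\phi|)$ such that for every $n\ge1$ $$\tau\Big(1-\tfrac12\eta\tau\Big)^2|\partial\phi|^2(U^n)\le\frac{d^2(U^n,U^{n-1})}{\tau}+\varepsilon,\qquad \Big(1-\tfrac{\eta-\lambda}{2}\tau\Big)\frac{d^2(U^n,U^{n-1})}{\tau}\le\phi(U^{n-1})-\phi(U^n)+\varepsilon.$$ Let $\bar U_\tau(0)=U^0$ and $\bar U_\tau(t)=U^n$ for $t\in((n-1)\tau,n\tau]$, $n\ge1$, and let $t_\tau:=\min\{k\tau:k\in\mathbb N,\ k\tau\ge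 t\}$. Then for every $u_0\in D$ and every $t>0$ $$d\big(\mathsf S_t(u_0),\bar U_\tau(t)\big)\le e^{-\lambda t}d(u_0,U^0)+\big(\sqrt{\tau t_\tau}+t_\tau-t\big)e^{\gamma t_\tau}\,|\partial\phi|(U^0)+2\sqrt{\frac{\varepsilon}{\tau}\,t_\tau\,\mathsf E_{2\gamma}(t_\tau)}.$$ -/

import Mathlib

open Filter Topology Set

noncomputable section

/-- The domain `{x | φ x < +∞}` of an extended-real functional. -/
def effDomain {X : Type*} (φ : X → EReal) : Set X := {x | φ x < ⊤}

/-- A metric-functional system: `φ : X → (-∞, +∞]` is proper and lower semicontinuous. -/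
structure IsMetricFunctionalSystem {X : Type*} [MetricSpace X] (φ : X → EReal) : Prop where
  ne_bot : ∀ x, φ x ≠ ⊥
  proper : (effDomain φ).Nonempty
  lsc : LowerSemicontinuous φ

open Classical in
/-- The metric slope `|∂φ|(x) = limsup_{y → x} (φ(x) - φ(y))⁺ / d(x, y)`, equal to `+∞` outside the
domain of `φ`. The `limsup` is over `y ≠ x` and is taken in `[0, +∞]`, so it is `0` at an isolated
point of the domain. -/
def metricSlope {X : Type*} [MetricSpace X] (φ : X → EReal) (x : X) : ENNReal :=
  if x ∈ effDomain φ then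
    limsup (fun y => (φ x - φ y).toENNReal / edist x y) (𝓝[≠] x)
  else ⊤

/-- The points at which the metric slope is finite. -/
def slopeDomain {X : Type*} [MetricSpace X] (φ : X → EReal) : Set X := {x | metricSlope φ x < ⊤}

/-- The upper right Dini derivative, with values in `[-∞, +∞]`. -/
def upperRightDini (ζ : ℝ → ℝ) (t : ℝ) : EReal :=
  limsup (fun h : ℝ => (((ζ (t + h) - ζ t) / h : ℝ) : EReal)) (𝓝[>] 0)

/-- Solutions `u : (0, +∞) → Dom φ` of the Evolution Variational Inequality `EVI_lam`; only the
values of `u` on `(0, +∞)` matter. -/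
structure IsEVISolution {X : Type*} [MetricSpace X] (φ : X → EReal) (lam : ℝ) (u : ℝ → X) :
    Prop where
  continuousOn : ContinuousOn u (Ioi 0)
  mem_domain : ∀ t, 0 < t → u t ∈ effDomain φ
  evi : ∀ t, 0 < t → ∀ v ∈ effDomain φ,
    ((1 / 2 : ℝ) : EReal) * upperRightDini (fun s => dist (u s) v ^ 2) t
        + ((lam / 2 * dist (u t) v ^ 2 : ℝ) : EReal)
      ≤ φ v - φ (u t)

/-- `S` is an `EVI_lam`-gradient flow of `φ` in `D ⊆ closure (Dom φ)`: a semigroup of continuous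
maps `S t : D → D`, `t ≥ 0`, whose trajectories solve `EVI_lam` and attain their initial value
continuously. Only the values `S t x` for `t ≥ 0` and `x ∈ D` matter. -/
structure IsEVIFlow {X : Type*} [MetricSpace X] (φ : X → EReal) (lam : ℝ) (D : Set X)
    (S : ℝ → X → X) : Prop where
  subset_closure : D ⊆ closure (effDomain φ)
  mapsTo : ∀ t, 0 ≤ t → MapsTo (S t) D D
  continuousOn : ∀ t, 0 ≤ t → ContinuousOn (S t) D
  semigroup : ∀ x ∈ D, ∀ t h, 0 ≤ t → 0 ≤ h → S (t + h) x = S h (S t x)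
  zero : ∀ x ∈ D, S 0 x = x
  tendsto_zero : ∀ x ∈ D, Tendsto (fun t => S t x) (𝓝[>] 0) (𝓝 x)
  evi : ∀ x ∈ D, IsEVISolution φ lam (fun t => S t x)

/-- `E_a(t) = ∫₀ᵗ exp (a r) dr`. -/
def expPrimitive (a t : ℝ) : ℝ := ∫ r in (0 : ℝ)..t, Real.exp (a * r)

/-- `t_τ = min {k τ : k ∈ ℕ, k τ ≥ t}`, for `τ > 0`. -/
def gridTime (τ t : ℝ) : ℝ := (⌈t / τ⌉₊ : ℝ) * τ

/-- The piecewise constant interpolant of a sequence, for `τ > 0` and `t ≥ 0`: it has the value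
`U n` on `((n - 1) τ, n τ]` and `U 0` at `0`. -/
def pcInterpolant {X : Type*} (τ : ℝ) (U : ℕ → X) (t : ℝ) : X := U ⌈t / τ⌉₊

end

/-! Compare the discrete points with the exact flow restarted at each of them. If `x = U n` and `y =
U (n + 1)`, the EVI tested at `y`, combined with the bound `φ x - φ (S t x) ≤ |∂φ|²(x) t e^{-2 lam
t}`, controls the local error `d²(S τ x, y)` by `τ² |∂φ|²(x)` minus energy terms. The discrete
energy inequality leaves a negative multiple of `d²(x, y)`, which the discrete slope inequality
turns into a negative multiple of `τ² |∂φ|²(y)` (`dist_sq_add_le_of_slope_of_energy`). The slope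
terms of successive steps thus nearly telescope, so the sum `Q` of the squared local errors,
suitably weighted, stays of order `τ²` when `ε = 0`.

The flow contracts with factor `e^{-lam t}`, so the local errors can be transported to the final
time. Cauchy–Schwarz over `N` steps costs a factor `N`, whence the rate `√(N τ²) = √(τ t_τ)`.
Arbitrary initial data and times off the grid follow from contraction and from the Lipschitz bound
on trajectories issuing from points of finite slope.

Everything about the flow is deduced from the EVI by a Grönwall lemma for upper Dini derivatives. -/

/-! ### Comparison and Grönwall for Dini derivatives. -/

theorem le_of_upperRightDini_lt_deriv_of_eq {ζ B B' R : ℝ → ℝ} {a b : ℝ} (hab : a < b)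
    (hζ : ContinuousOn ζ (Icc a b)) (hB : ∀ t, HasDerivAt B (B' t) t) (h0 : ζ a < B a)
    (hR : ∀ t ∈ Ioo a b, upperRightDini ζ t ≤ (R t : EReal))
    (hlt : ∀ t ∈ Ioo a b, ζ t = B t → R t < B' t) : ζ b ≤ B b := by
  have hBc : Continuous B := continuous_iff_continuousAt.2 fun t => (hB t).continuousAt
  -- The Dini bound is not assumed at `a` (the EVI says nothing at time 0), so the comparison starts
  -- slightly later, where the strict inequality persists by continuity.
  obtain ⟨a', ha', hle⟩ : ∃ a' ∈ Ioo a b, ζ a' < B a' := by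
    have h1 : Tendsto ζ (𝓝[Ioo a b] a) (𝓝 (ζ a)) :=
      (hζ a (left_mem_Icc.2 hab.le)).mono_left (nhdsWithin_mono _ Ioo_subset_Icc_self)
    have h2 : Tendsto B (𝓝[Ioo a b] a) (𝓝 (B a)) := hBc.continuousAt.mono_left nhdsWithin_le_nhds
    have : (𝓝[Ioo a b] a).NeBot := left_nhdsWithin_Ioo_neBot hab
    obtain ⟨t, ht1, ht2⟩ := ((h1.eventually_lt h2 h0).and self_mem_nhdsWithin).exists
    exact ⟨t, ht2, ht1⟩
  refine image_le_of_liminf_slope_right_lt_deriv_boundary' (f := ζ) (f' := R) (B' := B')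
    (a := a') (b := b) (hζ.mono (Icc_subset_Icc_left ha'.1.le)) ?_ hle.le hBc.continuousOn
    (fun t _ => (hB t).hasDerivWithinAt)
    (fun t ht => hlt t ⟨ha'.1.trans_le ht.1, ht.2⟩) (right_mem_Icc.2 ha'.2.le)
  intro t ht r hr
  have h1 : upperRightDini ζ t < (r : EReal) :=
    (hR t ⟨ha'.1.trans_le ht.1, ht.2⟩).trans_lt (by exact_mod_cast hr)
  have h2 := eventually_lt_of_limsup_lt h1
  have h3 : Tendsto (fun z => z - t) (𝓝[>] t) (𝓝[>] 0) := by
    refine tendsto_nhdsWithin_iff.2 ⟨?_, ?_⟩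
    · have : Tendsto (fun z => z - t) (𝓝 t) (𝓝 (t - t)) := by
        exact (continuous_id.sub continuous_const).tendsto t
      rw [sub_self] at this
      exact this.mono_left nhdsWithin_le_nhds
    · filter_upwards [self_mem_nhdsWithin] with z hz
      exact mem_Ioi.2 (sub_pos.2 (mem_Ioi.1 hz))
  refine (h3.eventually h2).frequently.mono ?_
  intro z hz
  rw [slope_def_field]
  have : t + (z - t) = z := by ring
  rw [this] at hz
  exact_mod_cast hz

theorem upperRightDini_gronwall {ζ K A : ℝ → ℝ} {lam a b : ℝ} (hab : a < b)
    (hζ : ContinuousOn ζ (Icc a b))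
    (hA : ∀ t, HasDerivAt A (Real.exp (lam * t) * K t) t)
    (hD : ∀ t ∈ Ioo a b, upperRightDini ζ t ≤ ((2 * K t - lam * ζ t : ℝ) : EReal)) :
    Real.exp (lam * b) * ζ b ≤ Real.exp (lam * a) * ζ a + 2 * (A b - A a) := by
  have key : ∀ δ > 0, ζ b ≤ Real.exp (-lam * b) *
      (Real.exp (lam * a) * ζ a + 2 * (A b - A a) + δ * (1 + b - a)) := by
    intro δ hδ
    -- In the perturbation, the `1` makes the barrier strictly larger at `a`, and the `t` makes its
    -- slope strictly larger at contact points.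
    set C := fun t => Real.exp (lam * a) * ζ a + 2 * (A t - A a) + δ * (1 + t - a) with hC
    have hCd : ∀ t, HasDerivAt C (2 * (Real.exp (lam * t) * K t) + δ) t := by
      intro t
      have h1 := (((hA t).sub_const (A a)).const_mul 2).const_add (Real.exp (lam * a) * ζ a)
      have h2 := (((hasDerivAt_id t).const_add 1).sub_const a).const_mul δ
      exact (h1.add h2).congr_deriv (by simp)
    have hE : ∀ t, HasDerivAt (fun t => Real.exp (-lam * t)) (Real.exp (-lam * t) * (-lam)) t := by
      intro t
      simpa using ((hasDerivAt_id t).const_mul (-lam)).exp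
    refine le_of_upperRightDini_lt_deriv_of_eq hab hζ (B := fun t => Real.exp (-lam * t) * C t)
      (fun t => (hE t).mul (hCd t)) ?_ hD ?_
    · have : Real.exp (-lam * a) * Real.exp (lam * a) = 1 := by
        rw [← Real.exp_add]; simp
      have h2 : Real.exp (-lam * a) * C a = ζ a + Real.exp (-lam * a) * δ := by
        simp only [hC]
        linear_combination (ζ a) * this
      rw [h2]
      have := mul_pos (Real.exp_pos (-lam * a)) hδ
      linarith
    · intro t _ ht
      have : Real.exp (-lam * t) * Real.exp (lam * t) = 1 := by
        rw [← Real.exp_add]; simp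
      have h3 := mul_pos (Real.exp_pos (-lam * t)) hδ
      have h4 : Real.exp (-lam * t) * (-lam) * C t
          + Real.exp (-lam * t) * (2 * (Real.exp (lam * t) * K t) + δ)
          = 2 * K t - lam * ζ t + Real.exp (-lam * t) * δ := by
        rw [ht]
        linear_combination (2 * K t) * this
      rw [h4]
      linarith
  have key2 : ζ b ≤ Real.exp (-lam * b) * (Real.exp (lam * a) * ζ a + 2 * (A b - A a)) := by
    have ht : Tendsto (fun δ : ℝ => Real.exp (-lam * b) *
      (Real.exp (lam * a) * ζ a + 2 * (A b - A a) + δ * (1 + b - a))) (𝓝[>] 0)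
      (𝓝 (Real.exp (-lam * b) *
      (Real.exp (lam * a) * ζ a + 2 * (A b - A a) + 0 * (1 + b - a)))) := by
      refine Tendsto.mono_left (Continuous.tendsto ?_ _) nhdsWithin_le_nhds
      fun_prop
    have := ge_of_tendsto ht (by filter_upwards [self_mem_nhdsWithin] with δ hδ using key δ hδ)
    simpa using this
  have h1 : Real.exp (lam * b) * Real.exp (-lam * b) = 1 := by
    rw [← Real.exp_add]; simp
  calc Real.exp (lam * b) * ζ b ≤ Real.exp (lam * b) * (Real.exp (-lam * b) *
        (Real.exp (lam * a) * ζ a + 2 * (A b - A a))) := by gcongr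
    _ = _ := by rw [← mul_assoc, h1, one_mul]

theorem upperRightDini_dist_sq_le {X : Type*} [MetricSpace X] {φ : X → EReal}
    (hφ : IsMetricFunctionalSystem φ) {lam : ℝ} {u : ℝ → X} (hu : IsEVISolution φ lam u)
    {t : ℝ} (ht : 0 < t) {v : X} (hv : v ∈ effDomain φ) :
    upperRightDini (fun s => dist (u s) v ^ 2) t
      ≤ ((2 * ((φ v).toReal - (φ (u t)).toReal) - lam * dist (u t) v ^ 2 : ℝ) : EReal) := by
  have h := hu.evi t ht v hv
  have h1 : φ v = ((φ v).toReal : EReal) := (EReal.coe_toReal (ne_of_lt hv) (hφ.ne_bot v)).symm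
  have h2 : φ (u t) = ((φ (u t)).toReal : EReal) :=
    (EReal.coe_toReal (ne_of_lt (hu.mem_domain t ht)) (hφ.ne_bot _)).symm
  generalize upperRightDini (fun s => dist (u s) v ^ 2) t = W at h ⊢
  rw [h1, h2] at h
  induction W with
  | bot => exact bot_le
  | top =>
    rw [EReal.coe_mul_top_of_pos (by norm_num), EReal.top_add_coe, ← EReal.coe_sub] at h
    exact absurd h (not_le.2 (EReal.coe_lt_top _))
  | coe w =>
    have h' : 1 / 2 * w + lam / 2 * dist (u t) v ^ 2
        ≤ (φ v).toReal - (φ (u t)).toReal := by exact_mod_cast h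
    have : w ≤ 2 * ((φ v).toReal - (φ (u t)).toReal) - lam * dist (u t) v ^ 2 := by linarith
    exact_mod_cast this

/-! ### Primitives of exponentials. -/

theorem hasDerivAt_expPrimitive (a t : ℝ) : HasDerivAt (expPrimitive a) (Real.exp (a * t)) t := by
  have hc : Continuous fun r => Real.exp (a * r) := by fun_prop
  exact intervalIntegral.integral_hasDerivAt_right (hc.intervalIntegrable _ _)
    (hc.stronglyMeasurableAtFilter _ _) hc.continuousAt

theorem expPrimitive_zero_right (a : ℝ) : expPrimitive a 0 = 0 := by simp [expPrimitive]

theorem mul_expPrimitive (a t : ℝ) : a * expPrimitive a t = Real.exp (a * t) - 1 := by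
  have : ∫ r in (0 : ℝ)..t, a * Real.exp (a * r) = Real.exp (a * t) - Real.exp (a * 0) := by
    refine intervalIntegral.integral_eq_sub_of_hasDerivAt (f := fun r => Real.exp (a * r))
      (fun r _ => ?_) (Continuous.intervalIntegrable (by fun_prop) _ _)
    simpa [mul_comm] using ((hasDerivAt_id r).const_mul a).exp
  rw [expPrimitive, ← intervalIntegral.integral_const_mul, this]
  simp

theorem exp_mul_expPrimitive_neg (a t : ℝ) :
    Real.exp (a * t) * expPrimitive (-a) t = expPrimitive a t := by
  rcases eq_or_ne a 0 with rfl | ha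
  · simp
  · have h1 := mul_expPrimitive a t
    have h2 := mul_expPrimitive (-a) t
    have h3 : Real.exp (a * t) * Real.exp (-a * t) = 1 := by rw [← Real.exp_add]; simp
    apply mul_left_cancel₀ ha
    linear_combination -h1 - Real.exp (a * t) * h2 - h3

theorem expPrimitive_le_sub_of_nonneg {a s t : ℝ} (ha : 0 ≤ a) (hst : s ≤ t) :
    (t - s) * Real.exp (a * s) ≤ expPrimitive a t - expPrimitive a s := by
  have hc : Continuous fun r => Real.exp (a * r) := by fun_prop
  rw [expPrimitive, expPrimitive, intervalIntegral.integral_interval_sub_left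
    (hc.intervalIntegrable _ _) (hc.intervalIntegrable _ _)]
  have h := intervalIntegral.integral_mono_on (μ := MeasureTheory.volume) hst
    (f := fun _ => Real.exp (a * s)) (g := fun r => Real.exp (a * r))
    (by simp) (hc.intervalIntegrable _ _)
    (fun r hr => Real.exp_le_exp.2 (mul_le_mul_of_nonneg_left hr.1 ha))
  simpa using h

theorem expPrimitive_le_of_nonpos {a t : ℝ} (ha : a ≤ 0) (ht : 0 ≤ t) : expPrimitive a t ≤ t := by
  have hc : Continuous fun r => Real.exp (a * r) := by fun_prop
  have h := intervalIntegral.integral_mono_on (μ := MeasureTheory.volume) ht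
    (f := fun r => Real.exp (a * r)) (g := fun _ => (1 : ℝ))
    (hc.intervalIntegrable _ _) (by simp)
    (fun r hr => Real.exp_le_one_iff.2 (mul_nonpos_of_nonpos_of_nonneg ha hr.1))
  simpa [expPrimitive] using h

theorem expPrimitive_nonneg {a t : ℝ} (ht : 0 ≤ t) : 0 ≤ expPrimitive a t :=
  intervalIntegral.integral_nonneg ht fun _ _ => (Real.exp_pos _).le

/-! ### Energy decay and contraction of the flow. -/

section
variable {X : Type*} [MetricSpace X] {φ : X → EReal} {lam : ℝ} {D : Set X} {S : ℝ → X → X}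

theorem IsMetricFunctionalSystem.coe_toReal (hφ : IsMetricFunctionalSystem φ) {x : X}
    (hx : x ∈ effDomain φ) : ((φ x).toReal : EReal) = φ x :=
  EReal.coe_toReal (ne_of_lt hx) (hφ.ne_bot x)

theorem IsMetricFunctionalSystem.toReal_le_toReal (hφ : IsMetricFunctionalSystem φ) {x y : X}
    (hy : y ∈ effDomain φ) (h : φ x ≤ φ y) : (φ x).toReal ≤ (φ y).toReal :=
  EReal.toReal_le_toReal h (hφ.ne_bot x) (ne_of_lt hy)

theorem IsEVIFlow.continuousOn_Ici (hS : IsEVIFlow φ lam D S) {x : X} (hx : x ∈ D) :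
    ContinuousOn (fun t => S t x) (Ici 0) := by
  intro t ht
  rcases eq_or_lt_of_le (mem_Ici.1 ht) with rfl | ht
  · have h := hS.tendsto_zero x hx
    rw [← Ioi_insert, continuousWithinAt_insert_self]
    change Tendsto _ _ (𝓝 (S 0 x))
    rwa [hS.zero x hx]
  · exact ((hS.evi x hx).continuousOn.continuousAt (Ioi_mem_nhds ht)).continuousWithinAt

theorem IsEVIFlow.mem_effDomain (hS : IsEVIFlow φ lam D S) {x : X} (hx : x ∈ D) {t : ℝ}
    (ht : 0 < t) : S t x ∈ effDomain φ := (hS.evi x hx).mem_domain t ht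

theorem IsEVIFlow.continuousOn_dist_sq (hS : IsEVIFlow φ lam D S) {x : X} (hx : x ∈ D) (v : X)
    {a b : ℝ} (ha : 0 ≤ a) : ContinuousOn (fun t => dist (S t x) v ^ 2) (Icc a b) := by
  have h : ContinuousOn (fun t => S t x) (Icc a b) :=
    (hS.continuousOn_Ici hx).mono (Icc_subset_Ici_self.trans (Ici_subset_Ici.2 ha))
  exact (continuous_dist.comp_continuousOn (h.prodMk continuousOn_const)).pow 2

/-- If the energy exceeded its value at `a`, consider the last time `c` at which it did not. Tested
at `S c x`, the EVI gives Grönwall for a squared distance starting from zero, so the curve never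
leaves `S c x`. -/
theorem IsEVIFlow.functional_antitone (hφ : IsMetricFunctionalSystem φ)
    (hS : IsEVIFlow φ lam D S) {x : X} (hx : x ∈ D) {a b : ℝ} (ha : 0 < a) (hab : a ≤ b) :
    φ (S b x) ≤ φ (S a x) := by
  by_contra! hlt
  set s := Icc a b ∩ (fun t => S t x) ⁻¹' (φ ⁻¹' Iic (φ (S a x))) with hs
  have hcl : IsClosed s :=
    ((hS.continuousOn_Ici hx).mono (fun t ht => ha.le.trans ht.1)).preimage_isClosed_of_isClosed
      isClosed_Icc (hφ.lsc.isClosed_preimage _)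
  have hcomp : IsCompact s := isCompact_Icc.of_isClosed_subset hcl inter_subset_left
  obtain ⟨c, hcs, hmax⟩ := hcomp.exists_isGreatest ⟨a, left_mem_Icc.2 hab, le_refl (φ (S a x))⟩
  have hc0 : 0 < c := ha.trans_le hcs.1.1
  have hcφ : φ (S c x) ≤ φ (S a x) := hcs.2
  have hcb : c < b := by
    refine lt_of_le_of_ne hcs.1.2 ?_
    rintro rfl
    exact absurd hcφ (not_le.2 hlt)
  have h := upperRightDini_gronwall (K := fun _ => 0) (A := fun _ => 0) (lam := lam) hcb
    (hS.continuousOn_dist_sq hx (S c x) hc0.le)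
    (fun t => by simpa using hasDerivAt_const t (0 : ℝ)) (fun t ht => by
      have ht0 : 0 < t := hc0.trans ht.1
      refine (upperRightDini_dist_sq_le hφ (hS.evi x hx) ht0 (hS.mem_effDomain hx hc0)).trans ?_
      have hge : φ (S c x) ≤ φ (S t x) := by
        refine hcφ.trans (le_of_lt ?_)
        by_contra! hle
        exact absurd (hmax ⟨⟨hcs.1.1.trans ht.1.le, ht.2.le⟩, hle⟩) (not_le.2 ht.1)
      have := hφ.toReal_le_toReal (hS.mem_effDomain hx ht0) hge
      exact EReal.coe_le_coe_iff.2 (by linarith))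
  have h2 : dist (S b x) (S c x) ^ 2 ≤ 0 := by
    simp only [dist_self, sub_self] at h
    have := Real.exp_pos (lam * b)
    by_contra! hpos
    nlinarith [mul_pos this hpos]
  have h3 : S b x = S c x := dist_eq_zero.1 (pow_eq_zero_iff (two_ne_zero)|>.1
    (le_antisymm h2 (sq_nonneg _)))
  rw [h3] at hlt
  exact absurd hcφ (not_le.2 hlt)

theorem IsEVIFlow.integrated_evi (hφ : IsMetricFunctionalSystem φ)
    (hS : IsEVIFlow φ lam D S) {x v : X} (hx : x ∈ D) (hv : v ∈ effDomain φ) {h : ℝ} (hh : 0 < h) :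
    Real.exp (lam * h) * dist (S h x) v ^ 2
      ≤ dist x v ^ 2 + 2 * (expPrimitive lam h * ((φ v).toReal - (φ (S h x)).toReal)) := by
  have := upperRightDini_gronwall (K := fun _ => (φ v).toReal - (φ (S h x)).toReal)
    (A := fun t => expPrimitive lam t * ((φ v).toReal - (φ (S h x)).toReal)) (lam := lam) hh
    (hS.continuousOn_dist_sq hx v le_rfl)
    (fun t => (hasDerivAt_expPrimitive lam t).mul_const _) (fun t ht => by
      refine (upperRightDini_dist_sq_le hφ (hS.evi x hx) ht.1 hv).trans ?_
      have := hφ.toReal_le_toReal (hS.mem_effDomain hx ht.1)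
        (hS.functional_antitone hφ hx ht.1 ht.2.le)
      exact EReal.coe_le_coe_iff.2 (by linarith))
  simpa [hS.zero x hx, expPrimitive_zero_right] using this

/-- One step of length `h` of the flow contracts, up to an error that telescopes over a grid. -/
theorem IsEVIFlow.dist_sq_step_le (hφ : IsMetricFunctionalSystem φ) (hlam : lam ≤ 0)
    (hS : IsEVIFlow φ lam D S) {x y : X} (hx : x ∈ D) (hy : y ∈ D) (hxφ : x ∈ effDomain φ)
    {h C : ℝ} (hh : 0 < h) (hmono : (φ (S h x)).toReal ≤ (φ x).toReal)
    (hC0 : 0 ≤ C) (hC : (φ (S h x)).toReal - (φ (S h y)).toReal ≤ C) :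
    Real.exp (2 * lam * h) * dist (S h x) (S h y) ^ 2
      ≤ dist x y ^ 2 + 2 * h * ((φ x).toReal - (φ (S h x)).toReal + -lam * h * C) := by
  -- The trajectory of `x` is tested at `S h y`, that of `y` at `x`. Adding `e` times the first
  -- inequality to the second cancels `d²(x, S h y)` and leaves the energy drop of `x` plus a term
  -- with factor `1 - e = O(h)`.
  have h1 := hS.integrated_evi hφ hx (hS.mem_effDomain hy hh) hh
  have h2 := hS.integrated_evi hφ hy hxφ hh
  rw [dist_comm (S h y) x, dist_comm y x] at h2
  set e := Real.exp (lam * h) with he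
  have he0 : 0 < e := Real.exp_pos _
  have hee : Real.exp (2 * lam * h) = e * e := by rw [he, ← Real.exp_add]; ring_nf
  have he1 : 1 - e ≤ -lam * h := by
    have := Real.add_one_le_exp (lam * h)
    linarith
  have he2 : 0 ≤ 1 - e := by
    have : e ≤ 1 := Real.exp_le_one_iff.2 (mul_nonpos_of_nonpos_of_nonneg hlam hh.le)
    linarith
  have hE := expPrimitive_le_of_nonpos hlam hh.le
  have hE0 := expPrimitive_nonneg (a := lam) hh.le
  have h3 : (1 - e) * ((φ (S h x)).toReal - (φ (S h y)).toReal) ≤ -lam * h * C :=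
    (mul_le_mul_of_nonneg_left hC he2).trans (mul_le_mul_of_nonneg_right he1 hC0)
  have h4 : 0 ≤ (φ x).toReal - (φ (S h x)).toReal + -lam * h * C := by
    have := mul_nonneg (mul_nonneg (neg_nonneg.2 hlam) hh.le) hC0
    linarith
  have h5 := mul_le_mul_of_nonneg_left h1 he0.le
  have h6 := mul_le_mul_of_nonneg_left (add_le_add_left h3
    ((φ x).toReal - (φ (S h x)).toReal)) hE0
  have h7 := mul_le_mul_of_nonneg_right hE h4
  rw [hee]
  nlinarith [h5, h6, h7, h2]

/-- Over `n` steps of length `T / n` the energy drops telescope, so the total error is `O(1 / n)`.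
Starting at `a > 0` keeps the energies finite. -/
theorem IsEVIFlow.dist_sq_contraction_of_pos (hφ : IsMetricFunctionalSystem φ) (hlam : lam ≤ 0)
    (hS : IsEVIFlow φ lam D S) {x y : X} (hx : x ∈ D) (hy : y ∈ D) {a T : ℝ} (ha : 0 < a)
    (hT : 0 < T) : Real.exp (2 * lam * T) * dist (S (a + T) x) (S (a + T) y) ^ 2
      ≤ dist (S a x) (S a y) ^ 2 := by
  set C := |(φ (S a x)).toReal| + |(φ (S (a + T) y)).toReal| with hC
  have hC0 : 0 ≤ C := by positivity
  have hant : ∀ z ∈ D, ∀ s t, a ≤ s → s ≤ t → (φ (S t z)).toReal ≤ (φ (S s z)).toReal :=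
    fun z hz s t hs hst => hφ.toReal_le_toReal (hS.mem_effDomain hz (ha.trans_le hs))
      (hS.functional_antitone hφ hz (ha.trans_le hs) hst)
  have hgrid : ∀ n : ℕ, 0 < n → ∀ k : ℕ, k ≤ n →
      Real.exp (2 * lam * (k * (T / n))) *
          dist (S (a + k * (T / n)) x) (S (a + k * (T / n)) y) ^ 2
        ≤ dist (S a x) (S a y) ^ 2 + 2 * (T / n) * ((φ (S a x)).toReal
          - (φ (S (a + k * (T / n)) x)).toReal + -lam * (k * (T / n)) * C) := by
    intro n hn k
    have hn' : (0 : ℝ) < n := by exact_mod_cast hn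
    set h := T / n with hh
    have hh0 : 0 < h := by positivity
    induction k with
    | zero => intro _; simp
    | succ k ih =>
      intro hk
      have ih := ih (by omega)
      set s := a + k * h with hs
      have hks : (0 : ℝ) ≤ k * h := by positivity
      have has : a ≤ s := by linarith
      have hsT : s + h ≤ a + T := by
        have h1 : ((k + 1 : ℕ) : ℝ) * h ≤ n * h :=
          mul_le_mul_of_nonneg_right (by exact_mod_cast hk) hh0.le
        have h2 : n * h = T := by rw [hh]; field_simp
        push_cast at h1
        linarith
      have hst : a + ((k + 1 : ℕ) : ℝ) * h = s + h := by push_cast; ring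
      rw [hst]
      have hs0 : 0 ≤ s := ha.le.trans has
      have hCC : (φ (S h (S s x))).toReal - (φ (S h (S s y))).toReal ≤ C := by
        rw [← hS.semigroup x hx s h hs0 hh0.le, ← hS.semigroup y hy s h hs0 hh0.le]
        have h1 := hant x hx a (s + h) le_rfl (by linarith)
        have h2 := hant y hy (s + h) (a + T) (by linarith) hsT
        have h3 := le_abs_self (φ (S a x)).toReal
        have h4 := neg_abs_le (φ (S (a + T) y)).toReal
        linarith
      have hm : (φ (S h (S s x))).toReal ≤ (φ (S s x)).toReal := by
        rw [← hS.semigroup x hx s h hs0 hh0.le]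
        exact hant x hx s (s + h) has (by linarith)
      have hstep := hS.dist_sq_step_le hφ hlam (hS.mapsTo s hs0 hx) (hS.mapsTo s hs0 hy)
        (hS.mem_effDomain hx (ha.trans_le has)) hh0 hm hC0 hCC
      have hm' : 0 ≤ (φ (S s x)).toReal - (φ (S h (S s x))).toReal + -lam * h * C := by
        have := mul_nonneg (mul_nonneg (neg_nonneg.2 hlam) hh0.le) hC0
        linarith
      rw [← hS.semigroup x hx s h hs0 hh0.le, ← hS.semigroup y hy s h hs0 hh0.le] at hstep
      rw [← hS.semigroup x hx s h hs0 hh0.le] at hm'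
      have he : Real.exp (2 * lam * (((k + 1 : ℕ) : ℝ) * h))
          = Real.exp (2 * lam * (k * h)) * Real.exp (2 * lam * h) := by
        rw [← Real.exp_add]; push_cast; ring_nf
      have he1 : Real.exp (2 * lam * (k * h)) ≤ 1 := by
        refine Real.exp_le_one_iff.2 ?_
        nlinarith
      rw [he, mul_assoc]
      have h1 := mul_le_mul_of_nonneg_left hstep (Real.exp_pos (2 * lam * (k * h))).le
      have h2 := mul_le_mul_of_nonneg_right he1 (mul_nonneg (mul_nonneg zero_le_two hh0.le) hm')
      push_cast
      nlinarith [h1, h2, ih]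
  set M := (φ (S a x)).toReal - (φ (S (a + T) x)).toReal + -lam * T * C with hM
  have hfin : ∀ n : ℕ, 0 < n → Real.exp (2 * lam * T) * dist (S (a + T) x) (S (a + T) y) ^ 2
      ≤ dist (S a x) (S a y) ^ 2 + 2 * T * M * (1 / n) := by
    intro n hn
    have h := hgrid n hn n le_rfl
    have hn' : (n : ℝ) * (T / n) = T := by
      have : (n : ℝ) ≠ 0 := by exact_mod_cast hn.ne'
      field_simp
    rw [hn'] at h
    refine h.trans (le_of_eq ?_)
    rw [← hM]; ring
  have ht : Tendsto (fun n : ℕ => dist (S a x) (S a y) ^ 2 + 2 * T * M * (1 / (n : ℝ))) atTop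
      (𝓝 (dist (S a x) (S a y) ^ 2 + 2 * T * M * 0)) :=
    (tendsto_one_div_atTop_nhds_zero_nat.const_mul _).const_add _
  have := ge_of_tendsto ht ((eventually_gt_atTop 0).mono hfin)
  simpa using this

theorem IsEVIFlow.dist_le_exp_mul (hφ : IsMetricFunctionalSystem φ) (hlam : lam ≤ 0)
    (hS : IsEVIFlow φ lam D S) {x y : X} (hx : x ∈ D) (hy : y ∈ D) {T : ℝ} (hT : 0 ≤ T) :
    dist (S T x) (S T y) ≤ Real.exp (-lam * T) * dist x y := by
  rcases hT.eq_or_lt with rfl | hT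
  · simp [hS.zero x hx, hS.zero y hy]
  have hl : Tendsto (fun a => Real.exp (2 * lam * T) *
      dist (S a (S T x)) (S a (S T y)) ^ 2) (𝓝[>] 0)
      (𝓝 (Real.exp (2 * lam * T) * dist (S T x) (S T y) ^ 2)) :=
    (((hS.tendsto_zero _ (hS.mapsTo T hT.le hx)).dist (hS.tendsto_zero _ (hS.mapsTo T hT.le hy))).pow 2).const_mul _
  have hr : Tendsto (fun a => dist (S a x) (S a y) ^ 2) (𝓝[>] 0) (𝓝 (dist x y ^ 2)) :=
    ((hS.tendsto_zero x hx).dist (hS.tendsto_zero y hy)).pow 2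
  have h := le_of_tendsto_of_tendsto hl hr (by
    filter_upwards [self_mem_nhdsWithin] with a ha
    have ha : 0 < a := ha
    have := hS.dist_sq_contraction_of_pos hφ hlam hx hy ha hT
    rwa [add_comm a T, hS.semigroup x hx T a hT.le ha.le,
      hS.semigroup y hy T a hT.le ha.le] at this)
  have hexp : Real.exp (-lam * T) ^ 2 * Real.exp (2 * lam * T) = 1 := by
    rw [← Real.exp_nat_mul, ← Real.exp_add]
    norm_num
    ring
  refine abs_le_of_sq_le_sq' ?_ (by positivity) |>.2
  calc dist (S T x) (S T y) ^ 2
      = Real.exp (-lam * T) ^ 2 * (Real.exp (2 * lam * T) * dist (S T x) (S T y) ^ 2) := by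
        rw [← mul_assoc, hexp, one_mul]
    _ ≤ Real.exp (-lam * T) ^ 2 * dist x y ^ 2 := by gcongr
    _ = _ := by ring

end

/-! ### Trajectories starting at points of finite slope. -/

section
variable {X : Type*} [MetricSpace X] {φ : X → EReal} {lam : ℝ} {D : Set X} {S : ℝ → X → X}

theorem slopeDomain_subset_effDomain : slopeDomain φ ⊆ effDomain φ := by
  intro x hx
  by_contra h
  have : metricSlope φ x < ⊤ := hx
  simp [metricSlope, h] at this

theorem IsMetricFunctionalSystem.eventually_sub_le (hφ : IsMetricFunctionalSystem φ) {x : X}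
    (hx : x ∈ slopeDomain φ) {σ : ℝ} (hσ : (metricSlope φ x).toReal < σ) :
    ∀ᶠ y in 𝓝 x, y ∈ effDomain φ → (φ x).toReal - (φ y).toReal ≤ σ * dist y x := by
  have hxe := slopeDomain_subset_effDomain hx
  have hσ0 : 0 < σ := ENNReal.toReal_nonneg.trans_lt hσ
  have h1 : metricSlope φ x < ENNReal.ofReal σ := (ENNReal.lt_ofReal_iff_toReal_lt hx.ne).2 hσ
  rw [metricSlope, if_pos hxe] at h1
  have h2 := eventually_nhdsWithin_iff.1 (eventually_lt_of_limsup_lt h1)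
  filter_upwards [h2] with y hy hye
  rcases eq_or_ne y x with rfl | hne
  · simp
  have h3 := hy hne
  have hd : 0 < dist x y := dist_pos.2 hne.symm
  rw [← hφ.coe_toReal hxe, ← hφ.coe_toReal hye, ← EReal.coe_sub, EReal.toENNReal_of_ne_top
    (EReal.coe_ne_top _), EReal.toReal_coe, edist_dist, ← ENNReal.ofReal_div_of_pos hd,
    ENNReal.ofReal_lt_ofReal_iff hσ0, div_lt_iff₀ hd] at h3
  rw [dist_comm]
  exact h3.le

/-- The EVI tested at `x` itself bounds the derivative of `d²` by `2 σ₁ d - lam d²`, so `(δ + σ t)²`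
is a barrier. The gap `σ - σ₁` absorbs the `lam` term for small times, and `δ ↓ 0` removes the
offset. -/
theorem IsEVIFlow.eventually_dist_le (hφ : IsMetricFunctionalSystem φ) (hlam : lam ≤ 0)
    (hS : IsEVIFlow φ lam D S) {x : X} (hx : x ∈ D) (hxs : x ∈ slopeDomain φ) {σ : ℝ}
    (hσ : (metricSlope φ x).toReal < σ) : ∀ᶠ h in 𝓝[>] (0 : ℝ), dist (S h x) x ≤ σ * h := by
  obtain ⟨σ₁, h1, h2⟩ := exists_between hσ
  have hσ0 : 0 < σ := ENNReal.toReal_nonneg.trans_lt hσ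
  have hσ1 : 0 < σ₁ := ENNReal.toReal_nonneg.trans_lt h1
  have hl : 0 ≤ -lam := neg_nonneg.2 hlam
  obtain ⟨T₀, hT₀, hT₀'⟩ := mem_nhdsGT_iff_exists_Ioo_subset.1
    ((hS.tendsto_zero x hx).eventually (hφ.eventually_sub_le hxs h1))
  have hT₁ : 0 < (σ - σ₁) / (σ * (-lam + 1)) := by
    apply div_pos (by linarith); positivity
  filter_upwards [Ioo_mem_nhdsGT hT₀, Ioo_mem_nhdsGT hT₁] with h hh0 hh1
  have hδ₀ : 0 < (σ - σ₁) / (-lam + 1) := by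
    apply div_pos (by linarith); positivity
  have key : ∀ᶠ δ in 𝓝[>] (0 : ℝ), dist (S h x) x ≤ δ + σ * h := by
    filter_upwards [Ioo_mem_nhdsGT hδ₀] with δ hδ
    have hδ0 : 0 < δ := hδ.1
    have hb : ∀ t, HasDerivAt (fun t => (δ + σ * t) ^ 2) (2 * (δ + σ * t) * σ) t := by
      intro t
      have := (((hasDerivAt_id t).const_mul σ).const_add δ).pow 2
      exact this.congr_deriv (by simp)
    have := le_of_upperRightDini_lt_deriv_of_eq hh0.1 (hS.continuousOn_dist_sq hx x le_rfl) hb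
      (by simp [hS.zero x hx, hδ0])
      (fun t ht => upperRightDini_dist_sq_le hφ (hS.evi x hx) ht.1
        (slopeDomain_subset_effDomain hxs)) (by
        intro t ht hEq
        have ht0 : 0 < t := ht.1
        have hbp : 0 < δ + σ * t := by positivity
        have hd : dist (S t x) x = δ + σ * t := by
          have := (sq_eq_sq₀ dist_nonneg hbp.le).1 hEq
          exact this
        have hsl : (φ x).toReal - (φ (S t x)).toReal ≤ σ₁ * dist (S t x) x :=
          hT₀' ⟨ht.1, ht.2.trans hh0.2⟩ (hS.mem_effDomain hx ht.1)
        rw [hd] at hsl ⊢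
        have hδ2 : δ * (-lam + 1) < σ - σ₁ := (lt_div_iff₀ (by positivity)).1 hδ.2
        have ht2 : t * (σ * (-lam + 1)) < σ - σ₁ :=
          (lt_div_iff₀ (by positivity)).1 (ht.2.trans hh1.2)
        have hst : 0 < σ * t := by positivity
        have hk : -lam * (δ + σ * t) < 2 * (σ - σ₁) := by nlinarith
        have := mul_lt_mul_of_pos_right hk hbp
        nlinarith)
    exact (abs_le_of_sq_le_sq' this (by have := hh0.1; positivity)).2
  have ht : Tendsto (fun δ : ℝ => δ + σ * h) (𝓝[>] 0) (𝓝 (0 + σ * h)) :=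
    (Continuous.tendsto (by fun_prop) _).mono_left nhdsWithin_le_nhds
  simpa using ge_of_tendsto ht key

theorem eventually_atTop_div_nat {p : ℝ → Prop} (hp : ∀ᶠ h in 𝓝[>] (0 : ℝ), p h) {t : ℝ}
    (ht : 0 < t) : ∀ᶠ n : ℕ in atTop, p (t / n) := by
  have : Tendsto (fun n : ℕ => t / n) atTop (𝓝[>] 0) := by
    refine tendsto_nhdsWithin_iff.2 ⟨tendsto_const_div_atTop_nhds_zero_nat t, ?_⟩
    filter_upwards [eventually_gt_atTop 0] with n hn
    have : (0 : ℝ) < n := by exact_mod_cast hn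
    exact mem_Ioi.2 (by positivity)
  exact this.eventually hp

theorem le_of_forall_gt_of_continuous {f : ℝ → ℝ} (hf : Continuous f) {s c : ℝ}
    (h : ∀ σ, s < σ → c ≤ f σ) : c ≤ f s :=
  ge_of_tendsto ((hf.tendsto s).mono_left nhdsWithin_le_nhds : Tendsto f (𝓝[>] s) _)
    (by filter_upwards [self_mem_nhdsWithin] with σ hσ using h σ hσ)

/-- Consecutive grid points of a trajectory are as far apart as its first step allows. -/
theorem IsEVIFlow.dist_step_le (hφ : IsMetricFunctionalSystem φ) (hlam : lam ≤ 0)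
    (hS : IsEVIFlow φ lam D S) {x : X} (hx : x ∈ D) {r h T c : ℝ} (hr : 0 ≤ r) (hrT : r ≤ T)
    (hh : 0 ≤ h) (hc : dist (S h x) x ≤ c) :
    dist (S (r + h) x) (S r x) ≤ Real.exp (-lam * T) * c := by
  rw [add_comm, hS.semigroup x hx h r hh hr]
  have h1 := hS.dist_le_exp_mul hφ hlam (hS.mapsTo h hh hx) hx hr
  have h2 : Real.exp (-lam * r) ≤ Real.exp (-lam * T) :=
    Real.exp_le_exp.2 (mul_le_mul_of_nonneg_left hrT (neg_nonneg.2 hlam))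
  exact h1.trans (mul_le_mul h2 hc dist_nonneg (Real.exp_pos _).le)

theorem IsEVIFlow.dist_self_le (hφ : IsMetricFunctionalSystem φ) (hlam : lam ≤ 0)
    (hS : IsEVIFlow φ lam D S) {x : X} (hx : x ∈ D) (hxs : x ∈ slopeDomain φ) {t : ℝ}
    (ht : 0 ≤ t) :
    dist (S t x) x ≤ (metricSlope φ x).toReal * t * Real.exp (-lam * t) := by
  rcases ht.eq_or_lt with rfl | ht
  · simp [hS.zero x hx]
  refine le_of_forall_gt_of_continuous (f := fun σ => σ * t * Real.exp (-lam * t))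
    (by fun_prop) fun σ hσ => ?_
  obtain ⟨n, hn, hn0⟩ := ((eventually_atTop_div_nat
    (hS.eventually_dist_le hφ hlam hx hxs hσ) ht).and (eventually_gt_atTop 0)).exists
  have hn' : (0 : ℝ) < n := by exact_mod_cast hn0
  have hnt : n * (t / n) = t := by field_simp
  set h := t / n with hh
  have hh0 : 0 < h := by positivity
  have hk : ∀ k : ℕ, k ≤ n → dist (S (k * h) x) x ≤ k * (Real.exp (-lam * t) * (σ * h)) := by
    intro k
    induction k with
    | zero => intro _; simp [hS.zero x hx]
    | succ k ih =>
      intro hk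
      have hkt : (k : ℝ) * h ≤ t := by
        rw [← hnt]
        exact mul_le_mul_of_nonneg_right (by exact_mod_cast (by omega : k ≤ n)) hh0.le
      have h1 := hS.dist_step_le hφ hlam hx (by positivity : (0 : ℝ) ≤ k * h) hkt hh0.le hn
      have h2 := dist_triangle (S (k * h + h) x) (S (k * h) x) x
      have h3 : ((k + 1 : ℕ) : ℝ) * h = k * h + h := by push_cast; ring
      rw [h3]
      push_cast
      linarith [ih (by omega)]
  have := hk n le_rfl
  rw [hnt] at this
  refine this.trans (le_of_eq ?_)
  linear_combination (Real.exp (-lam * t) * σ) * hnt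

/-- By contraction the curve has speed at most `e^{-lam r} σ` at time `r`, so the Dini derivative of
`d²(·, v)` is bounded below, and the EVI is read backwards as a bound on the energy difference. -/
theorem IsEVIFlow.functional_sub_le (hφ : IsMetricFunctionalSystem φ) (hlam : lam ≤ 0)
    (hS : IsEVIFlow φ lam D S) {x v : X} (hx : x ∈ D) (hxs : x ∈ slopeDomain φ)
    (hv : v ∈ effDomain φ) {σ : ℝ} (hσ : (metricSlope φ x).toReal < σ) {r : ℝ} (hr : 0 < r) :
    (φ (S r x)).toReal - (φ v).toReal
      ≤ dist (S r x) v * (Real.exp (-lam * r) * σ) + -lam / 2 * dist (S r x) v ^ 2 := by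
  set κ := Real.exp (-lam * r) * σ with hκ
  set A := dist (S r x) v with hA
  have hA0 : 0 ≤ A := dist_nonneg
  have hσ0 : 0 < σ := ENNReal.toReal_nonneg.trans_lt hσ
  have hκ0 : 0 < κ := by positivity
  have h1 : ((-2 * A * κ : ℝ) : EReal) ≤ upperRightDini (fun s => dist (S s x) v ^ 2) r := by
    have hev : ∀ᶠ h in 𝓝[>] (0 : ℝ), ((-2 * A * κ : ℝ) : EReal)
        ≤ (((dist (S (r + h) x) v ^ 2 - dist (S r x) v ^ 2) / h : ℝ) : EReal) := by
      filter_upwards [hS.eventually_dist_le hφ hlam hx hxs hσ, self_mem_nhdsWithin] with h hh hh0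
      have hh0 : 0 < h := hh0
      have h2 := hS.dist_step_le hφ hlam hx hr.le le_rfl hh0.le hh
      have h3 := dist_triangle_left (S r x) v (S (r + h) x)
      rw [EReal.coe_le_coe_iff, le_div_iff₀ hh0, ← hA]
      set B := dist (S (r + h) x) v with hB
      have hB0 : 0 ≤ B := dist_nonneg
      have h4 : A ≤ κ * h + B := by
        rw [hκ, mul_assoc]; linarith
      have hκh : 0 < κ * h := by positivity
      rcases le_total (κ * h) A with hc | hc
      · nlinarith
      · nlinarith
    exact le_limsup_of_frequently_le hev.frequently
  have h2 := h1.trans (upperRightDini_dist_sq_le hφ (hS.evi x hx) hr hv)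
  rw [EReal.coe_le_coe_iff] at h2
  linarith

/-- Sum `functional_sub_le` between consecutive grid points at distance `O(t / n)`; the quadratic
remainders add up to `O(1 / n)`. -/
theorem IsEVIFlow.functional_drop_le (hφ : IsMetricFunctionalSystem φ) (hlam : lam ≤ 0)
    (hS : IsEVIFlow φ lam D S) {x : X} (hx : x ∈ D) (hxs : x ∈ slopeDomain φ) {t : ℝ}
    (ht : 0 < t) : (φ x).toReal - (φ (S t x)).toReal
      ≤ (metricSlope φ x).toReal ^ 2 * t * Real.exp (-lam * t) ^ 2 := by
  refine le_of_forall_gt_of_continuous (f := fun σ => σ ^ 2 * t * Real.exp (-lam * t) ^ 2)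
    (by fun_prop) fun σ hσ => ?_
  have hσ0 : 0 < σ := ENNReal.toReal_nonneg.trans_lt hσ
  set E := Real.exp (-lam * t) with hE
  have hE1 : 1 ≤ E := Real.one_le_exp (mul_nonneg (neg_nonneg.2 hlam) ht.le)
  have hlim : Tendsto (fun n : ℕ => σ ^ 2 * t * E ^ 2 + -lam / 2 * E ^ 2 * σ ^ 2 * t * (t / n))
      atTop (𝓝 (σ ^ 2 * t * E ^ 2 + -lam / 2 * E ^ 2 * σ ^ 2 * t * 0)) :=
    ((tendsto_const_div_atTop_nhds_zero_nat t).const_mul _).const_add _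
  rw [mul_zero, add_zero] at hlim
  refine ge_of_tendsto hlim ?_
  filter_upwards [eventually_atTop_div_nat (hS.eventually_dist_le hφ hlam hx hxs hσ) ht,
    eventually_atTop_div_nat ((hS.tendsto_zero x hx).eventually (hφ.eventually_sub_le hxs hσ)) ht,
    eventually_gt_atTop 0] with n hn hsl hn0
  have hn' : (0 : ℝ) < n := by exact_mod_cast hn0
  have hnt : n * (t / n) = t := by field_simp
  set h := t / n with hh
  have hh0 : 0 < h := by positivity
  have hsl := hsl (hS.mem_effDomain hx hh0)
  set c := E ^ 2 * σ ^ 2 * h + -lam / 2 * (E * (σ * h)) ^ 2 with hc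
  have hk : ∀ k : ℕ, k ≤ n → (φ x).toReal - (φ (S (k * h) x)).toReal ≤ k * c := by
    intro k
    induction k with
    | zero => intro _; simp [hS.zero x hx]
    | succ k ih =>
      intro hk
      have hkt : (k : ℝ) * h ≤ t := by
        rw [← hnt]
        exact mul_le_mul_of_nonneg_right (by exact_mod_cast (by omega : k ≤ n)) hh0.le
      have h3 : ((k + 1 : ℕ) : ℝ) * h = k * h + h := by push_cast; ring
      have hstep : (φ (S (k * h) x)).toReal - (φ (S (k * h + h) x)).toReal ≤ c := by
        have hl0 : 0 ≤ -lam / 2 := by linarith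
        -- The first step starts at time 0, outside the reach of the EVI, so it uses the definition
        -- of the slope at `x`.
        rcases Nat.eq_zero_or_pos k with rfl | hk0
        · simp only [Nat.cast_zero, zero_mul, zero_add, hS.zero x hx]
          have h4 : σ * dist (S h x) x ≤ σ * (σ * h) := mul_le_mul_of_nonneg_left hn hσ0.le
          have h5 : 1 * (σ ^ 2 * h) ≤ E ^ 2 * (σ ^ 2 * h) :=
            mul_le_mul_of_nonneg_right (one_le_pow₀ hE1) (by positivity)
          have h6 : 0 ≤ -lam / 2 * (E * (σ * h)) ^ 2 := by positivity
          rw [hc]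
          linarith
        · have hk0' : (0 : ℝ) < k := by exact_mod_cast hk0
          have hkh : 0 < k * h := by positivity
          have h4 := hS.dist_step_le hφ hlam hx hkh.le hkt hh0.le hn
          rw [dist_comm] at h4
          have h5 := hS.functional_sub_le hφ hlam hx hxs
            (hS.mem_effDomain hx (by positivity : 0 < k * h + h)) hσ hkh
          have h6 : Real.exp (-lam * (k * h)) ≤ E :=
            Real.exp_le_exp.2 (mul_le_mul_of_nonneg_left hkt (neg_nonneg.2 hlam))
          refine h5.trans ?_
          calc _ ≤ (E * (σ * h)) * (E * σ) + -lam / 2 * (E * (σ * h)) ^ 2 := by gcongr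
            _ = c := by rw [hc]; ring
      rw [h3]
      push_cast
      linarith [ih (by omega)]
  have := hk n le_rfl
  rw [hnt] at this
  refine this.trans (le_of_eq ?_)
  rw [hc]
  linear_combination (E ^ 2 * σ ^ 2 + -lam / 2 * E ^ 2 * σ ^ 2 * h) * hnt

end

/-! ### Local error and its accumulation over the grid. -/

theorem expPrimitive_add (a s t : ℝ) :
    expPrimitive a (s + t) = expPrimitive a t + Real.exp (a * t) * expPrimitive a s := by
  rcases eq_or_ne a 0 with rfl | ha
  · simp [expPrimitive, add_comm]
  · apply mul_left_cancel₀ ha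
    have h : Real.exp (a * (s + t)) = Real.exp (a * t) * Real.exp (a * s) := by
      rw [← Real.exp_add]; ring_nf
    linear_combination mul_expPrimitive a (s + t) - mul_expPrimitive a t
      - Real.exp (a * t) * mul_expPrimitive a s + h

theorem le_expPrimitive {a t : ℝ} (ha : 0 ≤ a) (ht : 0 ≤ t) : t ≤ expPrimitive a t := by
  simpa [expPrimitive_zero_right] using expPrimitive_le_sub_of_nonneg ha ht

section
variable {X : Type*} [MetricSpace X] {φ : X → EReal} {lam : ℝ} {D : Set X} {S : ℝ → X → X}

theorem IsEVIFlow.dist_sq_le_of_slope (hφ : IsMetricFunctionalSystem φ) (hlam : lam ≤ 0)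
    (hS : IsEVIFlow φ lam D S) {x y : X} (hx : x ∈ D) (hxs : x ∈ slopeDomain φ)
    (hy : y ∈ effDomain φ) {τ : ℝ} (hτ : 0 < τ) :
    dist (S τ x) y ^ 2 ≤ Real.exp (-lam * τ) * dist x y ^ 2
      - 2 * expPrimitive (-lam) τ * ((φ x).toReal - (φ y).toReal)
      + (metricSlope φ x).toReal ^ 2 * Real.exp (-lam * τ) ^ 3 * τ ^ 2 := by
  set P := (φ x).toReal - (φ y).toReal with hP
  set s := (metricSlope φ x).toReal with hs
  set E := Real.exp (-lam * τ) with hE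
  -- The factor `e^{-lam t} ≥ 1` is inserted to cancel the Grönwall weight, so that the primitive is
  -- just `t² / 2`.
  have hg := upperRightDini_gronwall (K := fun t => -P + s ^ 2 * E ^ 2 * t * Real.exp (-lam * t))
    (A := fun t => -P * expPrimitive lam t + s ^ 2 * E ^ 2 * (t ^ 2 / 2)) (lam := lam) hτ
    (hS.continuousOn_dist_sq hx y le_rfl) (fun t => by
      have h1 := ((hasDerivAt_expPrimitive lam t).const_mul (-P)).add
        (((hasDerivAt_pow 2 t).div_const 2).const_mul (s ^ 2 * E ^ 2))
      refine h1.congr_deriv ?_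
      have : Real.exp (lam * t) * Real.exp (-lam * t) = 1 := by rw [← Real.exp_add]; simp
      push_cast
      linear_combination (-(s ^ 2 * E ^ 2 * t)) * this) (fun t ht => by
      refine (upperRightDini_dist_sq_le hφ (hS.evi x hx) ht.1 hy).trans ?_
      have ht0 : 0 < t := ht.1
      have h1 := hS.functional_drop_le hφ hlam hx hxs ht0
      have h2 : Real.exp (-lam * t) ≤ E :=
        Real.exp_le_exp.2 (mul_le_mul_of_nonneg_left ht.2.le (neg_nonneg.2 hlam))
      have h3 : 1 ≤ Real.exp (-lam * t) :=
        Real.one_le_exp (mul_nonneg (neg_nonneg.2 hlam) ht0.le)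
      have h4 : s ^ 2 * t * Real.exp (-lam * t) ^ 2
          ≤ s ^ 2 * E ^ 2 * t * Real.exp (-lam * t) :=
        calc _ ≤ s ^ 2 * t * E ^ 2 := by gcongr
          _ = s ^ 2 * E ^ 2 * t * 1 := by ring
          _ ≤ _ := by gcongr
      exact EReal.coe_le_coe_iff.2 (by linarith))
  simp only [mul_zero, Real.exp_zero, one_mul, hS.zero x hx, expPrimitive_zero_right] at hg
  have h1 : E * Real.exp (lam * τ) = 1 := by rw [hE, ← Real.exp_add]; simp
  have h2 : E * expPrimitive lam τ = expPrimitive (-lam) τ := by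
    have := exp_mul_expPrimitive_neg (-lam) τ
    rwa [neg_neg] at this
  have h3 := mul_le_mul_of_nonneg_left hg (Real.exp_pos (-lam * τ)).le
  rw [← hE, ← mul_assoc, h1, one_mul] at h3
  rw [← h2]
  refine h3.trans (le_of_eq ?_)
  ring

theorem IsEVIFlow.dist_sq_add_le_of_slope_of_energy (hφ : IsMetricFunctionalSystem φ)
    (hlam : lam ≤ 0) (hS : IsEVIFlow φ lam D S) {τ η ε : ℝ} (hτ : 0 < τ) (hη : 0 ≤ η)
    (hε : 0 ≤ ε) (hγτ : 4 * (2 * η - 3 * lam) * τ ≤ 1) :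
    ∃ c : ℝ, 0 ≤ c ∧ c ≤ 1 ∧
      Real.exp (-lam * τ) ^ 3 ≤ c * Real.exp (2 * (2 * η - 3 * lam) * τ) ∧
      ∀ x ∈ D ∩ slopeDomain φ, ∀ y ∈ effDomain φ,
        τ * (1 - 1 / 2 * η * τ) ^ 2 * (metricSlope φ y).toReal ^ 2 ≤ dist y x ^ 2 / τ + ε →
        (1 - (η - lam) / 2 * τ) * (dist y x ^ 2 / τ) ≤ (φ x).toReal - (φ y).toReal + ε →
        dist (S τ x) y ^ 2 + c * (τ ^ 2 * (metricSlope φ y).toReal ^ 2)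
          ≤ Real.exp (-lam * τ) ^ 3 * (τ ^ 2 * (metricSlope φ x).toReal ^ 2) + 4 * τ * ε := by
  obtain ⟨p, hp⟩ : ∃ p, p = -lam * τ := ⟨_, rfl⟩
  obtain ⟨q, hq⟩ : ∃ q, q = η * τ := ⟨_, rfl⟩
  obtain ⟨m, hm⟩ : ∃ m, m = expPrimitive (-lam) τ / τ := ⟨_, rfl⟩
  have hp0 : 0 ≤ p := hp ▸ mul_nonneg (neg_nonneg.2 hlam) hτ.le
  have hq0 : 0 ≤ q := hq ▸ mul_nonneg hη hτ.le
  have hpq : 4 * (2 * q + 3 * p) ≤ 1 := by rw [hp, hq]; linarith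
  have hmτ : expPrimitive (-lam) τ = m * τ := by rw [hm]; field_simp
  have hm1 : 1 ≤ m := by
    rw [hm, le_div_iff₀ hτ, one_mul]
    exact le_expPrimitive (neg_nonneg.2 hlam) hτ.le
  have hpm : Real.exp p = 1 + p * m := by
    have := mul_expPrimitive (-lam) τ
    rw [hmτ, ← hp] at this
    rw [hp] at this ⊢
    linarith
  have hm2 : m * (1 - p) ≤ 1 := by
    have h1 := exp_mul_expPrimitive_neg (-lam) τ
    have h2 := expPrimitive_le_of_nonpos (a := - -lam) (by linarith) hτ.le
    rw [← hp, hpm, hmτ] at h1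
    have h3 : (1 + p * m) * expPrimitive (- -lam) τ ≤ (1 + p * m) * τ :=
      mul_le_mul_of_nonneg_left h2 (by positivity)
    have h4 : m * τ ≤ (1 + p * m) * τ := h1 ▸ h3
    have := le_of_mul_le_mul_right h4 hτ
    linarith
  have hm3 : m ≤ 3 / 2 := by nlinarith
  -- Here `-c₀` is the coefficient of `d²(x, y)` left after adding `2 m` times the energy inequality
  -- to the flow estimate.
  obtain ⟨c₀, hc₀⟩ : ∃ c₀, c₀ = m * (2 - 2 * p - q) - 1 := ⟨_, rfl⟩
  have hc1 : c₀ ≤ 1 := by nlinarith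
  have hc2 : 1 - 2 * p - q ≤ c₀ := by nlinarith
  have hc3 : 0 ≤ c₀ := by linarith
  have hq2 : 1 - q ≤ (1 - 1 / 2 * q) ^ 2 := by nlinarith
  have hq3 : (1 - 1 / 2 * q) ^ 2 ≤ 1 := by nlinarith
  have hq4 : 0 ≤ (1 - 1 / 2 * q) ^ 2 := sq_nonneg _
  refine ⟨c₀ * (1 - 1 / 2 * q) ^ 2, mul_nonneg hc3 hq4, by nlinarith, ?_, ?_⟩
  · have h1 : Real.exp (2 * (2 * η - 3 * lam) * τ)
        = Real.exp (-lam * τ) ^ 3 * Real.exp (3 * p + 4 * q) := by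
      rw [← Real.exp_nat_mul, ← Real.exp_add, hp, hq]
      push_cast; ring_nf
    have h2 := Real.add_one_le_exp (3 * p + 4 * q)
    have h3 : (1 - 2 * p - q) * (1 - q) ≤ c₀ * (1 - 1 / 2 * q) ^ 2 :=
      mul_le_mul hc2 hq2 (by linarith) hc3
    have h4 : (1 - 2 * p - 2 * q) ≤ c₀ * (1 - 1 / 2 * q) ^ 2 := by nlinarith
    have h5 : (1 - 2 * p - 2 * q) * (3 * p + 4 * q + 1)
        ≤ c₀ * (1 - 1 / 2 * q) ^ 2 * Real.exp (3 * p + 4 * q) :=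
      mul_le_mul h4 h2 (by positivity) (mul_nonneg hc3 hq4)
    -- This holds because `4 γ τ ≤ 1`, that is `4 (2 q + 3 p) ≤ 1`.
    have h6 : 1 ≤ (1 - 2 * p - 2 * q) * (3 * p + 4 * q + 1) := by nlinarith
    rw [h1]
    have h7 := mul_le_mul_of_nonneg_left (h6.trans h5) (pow_pos (Real.exp_pos (-lam * τ)) 3).le
    linarith
  · intro x hx y hy hsl hen
    have h := hS.dist_sq_le_of_slope hφ hlam hx.1 hx.2 hy hτ
    rw [← hp, hmτ, hpm] at h
    rw [← hp, hpm]
    have hsl' : τ ^ 2 * (1 - 1 / 2 * q) ^ 2 * (metricSlope φ y).toReal ^ 2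
        ≤ dist y x ^ 2 + τ * ε := by
      have := mul_le_mul_of_nonneg_left hsl hτ.le
      rw [mul_add, mul_div_cancel₀ _ hτ.ne'] at this
      refine le_trans (le_of_eq ?_) this
      rw [hq]; ring
    have hen' : (1 - (q + p) / 2) * dist y x ^ 2
        ≤ τ * ((φ x).toReal - (φ y).toReal) + τ * ε := by
      have := mul_le_mul_of_nonneg_left hen hτ.le
      have h2 : τ * ((1 - (η - lam) / 2 * τ) * (dist y x ^ 2 / τ))
          = (1 - (q + p) / 2) * dist y x ^ 2 := by
        rw [hp, hq]; field_simp; ring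
      rw [h2] at this
      linarith
    have h1 := mul_le_mul_of_nonneg_left hsl' hc3
    have h2 := mul_le_mul_of_nonneg_left hen' (by linarith : 0 ≤ 2 * m)
    have h3 : (c₀ + 2 * m) * (τ * ε) ≤ 4 * (τ * ε) :=
      mul_le_mul_of_nonneg_right (by linarith) (by positivity)
    rw [dist_comm x y] at h
    have h4 : (1 + p * m) * dist y x ^ 2 - 2 * m * ((1 - (q + p) / 2) * dist y x ^ 2)
        = -(c₀ * dist y x ^ 2) := by rw [hc₀]; ring
    linarith

/-- Inductive form of Cauchy–Schwarz for a sum of `N + 1` errors, where `b` transports the earlier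
ones. -/
theorem add_sq_le_succ_mul {N : ℕ} {a b Q e : ℝ} (hQ : 0 ≤ Q) (ha : a ^ 2 ≤ N * Q) :
    (b * a + e) ^ 2 ≤ (N + 1) * (b ^ 2 * Q + e ^ 2) := by
  have hN : (0 : ℝ) ≤ N := N.cast_nonneg
  have hb : (b * a) ^ 2 ≤ N * (b ^ 2 * Q) := by
    rw [mul_pow]
    nlinarith [mul_le_mul_of_nonneg_left ha (sq_nonneg b)]
  have hbQ : 0 ≤ b ^ 2 * Q := by positivity
  have h1 : (2 * (b * a) * e) ^ 2 ≤ (b ^ 2 * Q + N * e ^ 2) ^ 2 := by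
    have h2 := mul_le_mul_of_nonneg_right hb (sq_nonneg e)
    nlinarith [sq_nonneg (b ^ 2 * Q - N * e ^ 2)]
  have h3 := (abs_le_of_sq_le_sq' h1 (by positivity)).2
  nlinarith

theorem IsEVIFlow.dist_grid_sq_le (hφ : IsMetricFunctionalSystem φ)
    (hlam : lam ≤ 0) (hS : IsEVIFlow φ lam D S) {τ η ε γ : ℝ} (hτ : 0 < τ) (hη : 0 ≤ η)
    (hε : 0 ≤ ε) (hγ : γ = 2 * η - 3 * lam) (hγτ : 4 * γ * τ ≤ 1)
    {U : ℕ → X} (hU : ∀ n, U n ∈ D ∩ slopeDomain φ)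
    (hslope : ∀ n : ℕ, τ * (1 - 1 / 2 * η * τ) ^ 2 * (metricSlope φ (U (n + 1))).toReal ^ 2
        ≤ dist (U (n + 1)) (U n) ^ 2 / τ + ε)
    (henergy : ∀ n : ℕ, (1 - (η - lam) / 2 * τ) * (dist (U (n + 1)) (U n) ^ 2 / τ)
        ≤ (φ (U n)).toReal - (φ (U (n + 1))).toReal + ε) (N : ℕ) :
    dist (S (N * τ) (U 0)) (U N) ^ 2 ≤ N * (τ ^ 2 * (metricSlope φ (U 0)).toReal ^ 2
      * Real.exp (2 * γ * (N * τ)) + 4 * ε * expPrimitive (2 * γ) (N * τ)) := by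
  subst hγ
  obtain ⟨c, hc0, hc1, hcθ, hstep⟩ :=
    hS.dist_sq_add_le_of_slope_of_energy hφ hlam hτ hη hε hγτ
  set θ := Real.exp (2 * (2 * η - 3 * lam) * τ) with hθ
  set E := Real.exp (-lam * τ) with hE
  have hE1 : 1 ≤ E := Real.one_le_exp (mul_nonneg (neg_nonneg.2 hlam) hτ.le)
  have hEθ : E ^ 2 ≤ θ :=
    calc E ^ 2 ≤ E ^ 3 := pow_le_pow_right₀ hE1 (by norm_num)
      _ ≤ c * θ := hcθ
      _ ≤ 1 * θ := by gcongr
      _ = θ := one_mul θ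
  have hγ0 : 0 ≤ 2 * (2 * η - 3 * lam) := by linarith
  -- `Q` is the sum of squared local errors, each amplified by `E²` per later step. Adding the slope
  -- term gives a quantity that grows per step by at most the factor `θ`, plus `4 τ ε`: the old `Q`
  -- needs `E² ≤ θ`, the slope term `E³ ≤ c θ`, the start `c ≤ 1`.
  have key : ∃ Q : ℝ, 0 ≤ Q ∧ dist (S (N * τ) (U 0)) (U N) ^ 2 ≤ N * Q ∧
      Q + c * (τ ^ 2 * (metricSlope φ (U N)).toReal ^ 2)
        ≤ τ ^ 2 * (metricSlope φ (U 0)).toReal ^ 2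
            * Real.exp (2 * (2 * η - 3 * lam) * (N * τ))
          + 4 * ε * expPrimitive (2 * (2 * η - 3 * lam)) (N * τ) := by
    induction N with
    | zero =>
      refine ⟨0, le_rfl, by simp [hS.zero _ (hU 0).1], ?_⟩
      simp only [Nat.cast_zero, zero_mul, mul_zero, Real.exp_zero, expPrimitive_zero_right,
        zero_add, add_zero, mul_one]
      exact mul_le_of_le_one_left (by positivity) hc1
    | succ N ih =>
      obtain ⟨Q, hQ, hdist, hbound⟩ := ih
      have hNτ : (0 : ℝ) ≤ N * τ := by positivity
      have hcast : ((N + 1 : ℕ) : ℝ) * τ = N * τ + τ := by push_cast; ring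
      refine ⟨E ^ 2 * Q + dist (S τ (U N)) (U (N + 1)) ^ 2, by positivity, ?_, ?_⟩
      · rw [hcast, hS.semigroup _ (hU 0).1 _ τ hNτ hτ.le]
        have h1 := dist_triangle (S τ (S (N * τ) (U 0))) (S τ (U N)) (U (N + 1))
        have h2 := hS.dist_le_exp_mul hφ hlam (hS.mapsTo _ hNτ (hU 0).1) (hU N).1 hτ.le
        push_cast
        refine le_trans ?_ (add_sq_le_succ_mul hQ hdist)
        exact pow_le_pow_left₀ dist_nonneg (h1.trans (add_le_add_left h2 _)) 2
      · have h1 := hstep (U N) (hU N) (U (N + 1))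
          (slopeDomain_subset_effDomain (hU (N + 1)).2) (hslope N) (henergy N)
        have h2 : E ^ 2 * Q ≤ θ * Q := by gcongr
        have h3 : E ^ 3 * (τ ^ 2 * (metricSlope φ (U N)).toReal ^ 2)
            ≤ c * θ * (τ ^ 2 * (metricSlope φ (U N)).toReal ^ 2) := by gcongr
        have h4 := mul_le_mul_of_nonneg_left hbound (Real.exp_pos
          (2 * (2 * η - 3 * lam) * τ)).le
        rw [← hθ] at h4
        have h5 := mul_le_mul_of_nonneg_left (le_expPrimitive hγ0 hτ.le)
          (by positivity : 0 ≤ 4 * ε)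
        have h6 : Real.exp (2 * (2 * η - 3 * lam) * (N * τ + τ))
            = θ * Real.exp (2 * (2 * η - 3 * lam) * (N * τ)) := by
          rw [hθ, ← Real.exp_add]; ring_nf
        rw [hcast, expPrimitive_add, h6, ← hθ]
        linarith
  obtain ⟨Q, hQ, hdist, hbound⟩ := key
  refine hdist.trans (mul_le_mul_of_nonneg_left ?_ N.cast_nonneg)
  have : 0 ≤ c * (τ ^ 2 * (metricSlope φ (U N)).toReal ^ 2) := by positivity
  linarith

end
-- Arbitrary initial points and times.
theorem theorem5p5 {X : Type*} [MetricSpace X] (φ : X → EReal)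
    (hφ : IsMetricFunctionalSystem φ)
    (lam : ℝ) (hlam : lam ≤ 0)
    (D : Set X) (S : ℝ → X → X) (hS : IsEVIFlow φ lam D S)
    (τ η ε γ : ℝ) (hτ : 0 < τ) (hη : 0 ≤ η) (hε : 0 ≤ ε)
    (hγ : γ = 2 * η - 3 * lam) (hγτ : 4 * γ * τ ≤ 1)
    (U : ℕ → X) (hU : ∀ n, U n ∈ D ∩ slopeDomain φ)
    (hslope : ∀ n : ℕ,
      τ * (1 - 1 / 2 * η * τ) ^ 2 * (metricSlope φ (U (n + 1))).toReal ^ 2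
        ≤ dist (U (n + 1)) (U n) ^ 2 / τ + ε)
    (henergy : ∀ n : ℕ,
      (1 - (η - lam) / 2 * τ) * (dist (U (n + 1)) (U n) ^ 2 / τ)
        ≤ (φ (U n)).toReal - (φ (U (n + 1))).toReal + ε)
    (u₀ : X) (hu₀ : u₀ ∈ D) (t : ℝ) (ht : 0 < t) :
    dist (S t u₀) (pcInterpolant τ U t)
      ≤ Real.exp (-lam * t) * dist u₀ (U 0)
        + (√(τ * gridTime τ t) + gridTime τ t - t) * Real.exp (γ * gridTime τ t)
            * (metricSlope φ (U 0)).toReal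
        + 2 * √(ε / τ * gridTime τ t * expPrimitive (2 * γ) (gridTime τ t)) := by
  have hUD : ∀ n, U n ∈ D := fun n => (hU n).1
  set N := ⌈t / τ⌉₊ with hN
  set s := (metricSlope φ (U 0)).toReal with hs
  have hs0 : 0 ≤ s := ENNReal.toReal_nonneg
  have hgrid : gridTime τ t = N * τ := rfl
  have hpc : pcInterpolant τ U t = U N := rfl
  have htN : t ≤ N * τ := (div_le_iff₀ hτ).1 (Nat.le_ceil (t / τ))
  have hNτ : (0 : ℝ) ≤ N * τ := ht.le.trans htN
  rw [hgrid, hpc]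
  have h1 := hS.dist_le_exp_mul hφ hlam hu₀ (hUD 0) ht.le
  have h2 : dist (S t (U 0)) (S (N * τ) (U 0)) ≤ (N * τ - t) * Real.exp (γ * (N * τ)) * s := by
    have hd : 0 ≤ N * τ - t := sub_nonneg.2 htN
    have hsem : S (N * τ) (U 0) = S t (S (N * τ - t) (U 0)) := by
      rw [← hS.semigroup _ (hUD 0) _ t hd ht.le, sub_add_cancel]
    have ha := hS.dist_le_exp_mul hφ hlam (hS.mapsTo _ hd (hUD 0)) (hUD 0) ht.le
    have hb := hS.dist_self_le hφ hlam (hUD 0) (hU 0).2 hd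
    rw [dist_comm, hsem]
    calc _ ≤ Real.exp (-lam * t) * (s * (N * τ - t) * Real.exp (-lam * (N * τ - t))) :=
          ha.trans (mul_le_mul_of_nonneg_left hb (Real.exp_pos _).le)
      _ = (N * τ - t) * (Real.exp (-lam * t) * Real.exp (-lam * (N * τ - t))) * s := by ring
      _ = (N * τ - t) * Real.exp (-lam * (N * τ)) * s := by
          rw [← Real.exp_add]; ring_nf
      _ ≤ _ := by
          have : -lam ≤ γ := by linarith
          gcongr
  have h3 : dist (S (N * τ) (U 0)) (U N) ≤ √(τ * (N * τ)) * Real.exp (γ * (N * τ)) * s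
      + 2 * √(ε / τ * (N * τ) * expPrimitive (2 * γ) (N * τ)) := by
    have hsq := hS.dist_grid_sq_le hφ hlam hτ hη hε hγ hγτ hU hslope henergy N
    have hE0 : 0 ≤ expPrimitive (2 * γ) (N * τ) := expPrimitive_nonneg hNτ
    have hF : 0 ≤ ε / τ * (N * τ) * expPrimitive (2 * γ) (N * τ) := by positivity
    refine (abs_le_of_sq_le_sq' (hsq.trans ?_) (by positivity)).2
    have hr1 : √(τ * (N * τ)) ^ 2 = τ * (N * τ) := Real.sq_sqrt (by positivity)
    have hr2 := Real.sq_sqrt hF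
    have hexp : Real.exp (2 * γ * (N * τ)) = Real.exp (γ * (N * τ)) ^ 2 := by
      rw [← Real.exp_nat_mul]; push_cast; ring_nf
    -- The sum of two squares is at most the square of the sum, which splits the root into the slope
    -- and `ε` terms.
    have hcross : 0 ≤ √(τ * (N * τ)) * Real.exp (γ * (N * τ)) * s
      * √(ε / τ * (N * τ) * expPrimitive (2 * γ) (N * τ)) := by positivity
    have hε' : ε / τ * (N * τ) = N * ε := by field_simp
    rw [hexp, add_sq, mul_pow, mul_pow, mul_pow, hr1, hr2, hε']
    rw [hε'] at hcross
    linarith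
  have h4 := dist_triangle4 (S t u₀) (S t (U 0)) (S (N * τ) (U 0)) (U N)
  linarith
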